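/- Let $\gamma\ge 0$ be real and let $w(x,t)=e^{-x^2}|x-t|^{\gamma}$, $x,t\in\mathbb R$. For every $t\in\mathbb R$ there is a unique sequence of monic polynomials $p_n$, $\deg p_n=n$ ($n\ge 0$), orthogonal on $\mathbb R$ with respect to $w(x,t)\,dx$. These polynomials satisfy a three-term recurrence $$z\,p_n(z)=p_{n+1}(z)+\alpha_n(t)\,p_n(z)+\beta_n(t)\,p_{n-1}(z)\quad (n\ge 0),\qquad \beta_0p_{-1}=0.$$ For every $n\ge 0$ the diagonal recurrence coefficient $\alpha_n$ is a twice continuously differentiable function of $t\in\mathbb R$, and for every real $t$ $$2\alpha_n\alpha_n''=(\alpha_n')^2+12\alpha_n^4-16t\,\alpha_n^3+4(t^2-\gamma-2n-1)\alpha_n^2-\gamma^2 .$$ Consequently, at every $t$ with $\alpha_n(t)\ne 0$, $$\alpha_n''=\frac{(\alpha_n')^2}{2\alpha_n}+6\alpha_n^3-8t\,\alpha_n^2+2(t^2-\gamma-2n-1)\alpha_n-\frac{\gamma^2}{2\alpha_n}.$$ This is a particular Painlevé IV equation: the function $y(s)=2\alpha_n(-s)$ satisfies $$y''=\frac{(y')^2}{2y}+\frac32y^3+4s\,y^2+2(s^2-a)\,y+\frac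 by,\qquad a=2n+1+\gamma,\quad b=-2\gamma^2,$$ on the open set of all $s$ with $y(s)\neq 0$. -/

import Mathlib

open MeasureTheory Polynomial

/-- The Hermite weight perturbed by a factor vanishing at `t`: `w(x,t) = exp(-x²) |x - t|^γ`. -/
noncomputable def perturbedHermiteWeight (γ t x : ℝ) : ℝ :=
  Real.exp (-x ^ 2) * |x - t| ^ γ

/-- `p` is a sequence of monic orthogonal polynomials, `deg p n = n`, for the weight `w` on `ℝ`. -/
structure IsMonicOrthogonal (w : ℝ → ℝ) (p : ℕ → ℝ[X]) : Prop where
  monic : ∀ n, (p n).Monic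
  natDegree_eq : ∀ n, (p n).natDegree = n
  integrable : ∀ m n, Integrable (fun x : ℝ => (p m).eval x * (p n).eval x * w x)
  orthogonal : ∀ m n, m ≠ n → ∫ x : ℝ, (p m).eval x * (p n).eval x * w x = 0
  norm_pos : ∀ n, 0 < ∫ x : ℝ, (p n).eval x * (p n).eval x * w x

/-- `z pₙ(z) = pₙ₊₁(z) + αₙ pₙ(z) + βₙ pₙ₋₁(z)` for all `n ≥ 0`, with `β₀ p₋₁ = 0`. -/
structure HasRecurrenceCoeffs (p : ℕ → ℝ[X]) (α β : ℕ → ℝ) : Prop where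
  zero : X * p 0 = p 1 + C (α 0) * p 0
  succ : ∀ n, X * p (n + 1) = p (n + 2) + C (α (n + 1)) * p (n + 1) + C (β (n + 1)) * p n

/-- `y` is a zero-free solution, on the open set `U`, of the fourth Painlevé equation
`y'' = y'² / (2 y) + (3/2) y³ + 4 s y² + 2 (s² - a) y + b / y` with parameters `a`, `b`. -/
structure IsPainleveFourSolutionOn (a b : ℝ) (y : ℝ → ℝ) (U : Set ℝ) : Prop where
  isOpen : IsOpen U
  contDiffOn : ContDiffOn ℝ 2 y U
  ne_zero : ∀ s ∈ U, y s ≠ 0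
  equation : ∀ s ∈ U, deriv (deriv y) s =
    (deriv y s) ^ 2 / (2 * y s) + 3 / 2 * (y s) ^ 3 + 4 * s * (y s) ^ 2
      + 2 * (s ^ 2 - a) * y s + b / y s

/-!
Translating `x = u + t` turns the weight, up to the factor `exp(-t²)`, into
`|u|^γ exp(-u² - 2tu)`. Two features of this weight are used, both stated for the linear functional
`L_t p = ∫ p(u) |u|^γ exp(-u² - 2tu) du` on polynomials, so that everything else is algebra.

* The parameter `t` enters only through `exp(-2tu)`, so `d/dt L_t(Xᵏ) = -2 L_t(Xᵏ⁺¹)`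
  (`isTodaFlow_perturbed`). The Stieltjes recursion shows that the recurrence coefficients `aₙ`,
  `bₙ` of `L_t` are differentiable in `t`, and they satisfy the Toda equations
  `aₙ' = 2 (bₙ - bₙ₊₁)` and `bₙ' = -2 bₙ (aₙ - aₙ₋₁)` (`hasDerivAt_diagCoeff`,
  `hasDerivAt_offDiagCoeff_succ`).
* The derivative of `u p(u) |u|^γ exp(-u² - 2tu)` has integral zero
  (`isPearsonFunctional_perturbed`). This gives a lowering relation expressing `X Pₙ'` through `Pₙ`
  and `Pₙ₋₁` (`X_mul_derivative_orthoPoly`), and with `αₙ = aₙ + t` the two string equations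
  `2 (bₙ₊₁ + bₙ + aₙ αₙ) = 2n + 1 + γ` (`string_equation_add`) and
  `4 bₙ αₙ αₙ₋₁ = (2bₙ - n) (2bₙ - n - γ)` (`string_equation_mul`).

The numbers `αₙ` are the diagonal recurrence coefficients of the translated polynomials, which are
orthogonal for the original weight. Eliminating the neighbouring coefficients leaves
`αₙ' = 2 αₙ (αₙ - t) + 4 bₙ - 2n - γ` and an expression for `αₙ bₙ'` in `αₙ` and `bₙ` alone;
differentiating the former once more and eliminating `bₙ` gives the equation for `αₙ`
(`contDiff_two_and_equation`).
-/

/-! ### Monic orthogonal polynomials of a positive definite functional -/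

/-- A linear functional on polynomials which is positive on squares of nonzero polynomials. -/
def IsPosDefFunctional (L : ℝ[X] →ₗ[ℝ] ℝ) : Prop :=
  ∀ p : ℝ[X], p ≠ 0 → 0 < L (p * p)

/-- The monic orthogonal polynomials of the functional `L`, defined by the Stieltjes recursion:
the recurrence coefficients are computed from the two preceding polynomials. -/
noncomputable def orthoPoly (L : ℝ[X] →ₗ[ℝ] ℝ) : ℕ → ℝ[X]
  | 0 => 1
  | 1 => X - C (L X / L 1)
  | n + 2 =>
    (X - C (L (X * (orthoPoly L (n + 1) * orthoPoly L (n + 1))) /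
        L (orthoPoly L (n + 1) * orthoPoly L (n + 1)))) * orthoPoly L (n + 1) -
      C (L (orthoPoly L (n + 1) * orthoPoly L (n + 1)) / L (orthoPoly L n * orthoPoly L n)) *
        orthoPoly L n

/-- The squared norm `hₙ = L (Pₙ²)`. -/
noncomputable def orthoNorm (L : ℝ[X] →ₗ[ℝ] ℝ) (n : ℕ) : ℝ :=
  L (orthoPoly L n * orthoPoly L n)

/-- The diagonal recurrence coefficient `aₙ = L (X Pₙ²) / hₙ`. -/
noncomputable def diagCoeff (L : ℝ[X] →ₗ[ℝ] ℝ) (n : ℕ) : ℝ :=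
  L (X * (orthoPoly L n * orthoPoly L n)) / orthoNorm L n

/-- The off-diagonal recurrence coefficient `bₙ = hₙ / hₙ₋₁`, with the convention `b₀ = 0`. -/
noncomputable def offDiagCoeff (L : ℝ[X] →ₗ[ℝ] ℝ) : ℕ → ℝ
  | 0 => 0
  | n + 1 => orthoNorm L (n + 1) / orthoNorm L n

/-- The polynomial `Rₙ = (X - aₙ) Pₙ - Pₙ₊₁`. It equals `bₙ Pₙ₋₁`, but makes sense also
for `n = 0`, where it vanishes. -/
noncomputable def orthoRem (L : ℝ[X] →ₗ[ℝ] ℝ) (n : ℕ) : ℝ[X] :=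
  (X - C (diagCoeff L n)) * orthoPoly L n - orthoPoly L (n + 1)

theorem degree_sub_C_coeff_mul_lt {p q : ℝ[X]} {n : ℕ} (hp : p.Monic) (hn : p.natDegree = n)
    (hq : q.degree < (n + 1 : ℕ)) : (q - C (q.coeff n) * p).degree < n := by
  rw [degree_lt_iff_coeff_zero] at hq ⊢
  intro m hm
  rw [coeff_sub, coeff_C_mul]
  rcases hm.eq_or_lt with rfl | hm
  · have : p.coeff n = 1 := by rw [← hn]; exact hp
    rw [this]; ring
  · rw [hq m hm, coeff_eq_zero_of_natDegree_lt (hn.symm ▸ hm : p.natDegree < m)]; ring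

theorem degree_C_mul_le_degree (c : ℝ) (p : ℝ[X]) : (C c * p).degree ≤ p.degree := by
  rw [← smul_eq_C_mul]; exact degree_smul_le c p

section Functional

variable (L : ℝ[X] →ₗ[ℝ] ℝ)

theorem map_C_mul (c : ℝ) (p : ℝ[X]) : L (C c * p) = c * L p := by
  rw [← smul_eq_C_mul, map_smul, smul_eq_mul]

@[simp] theorem orthoPoly_zero : orthoPoly L 0 = 1 := by rw [orthoPoly]

theorem orthoPoly_one : orthoPoly L 1 = X - C (diagCoeff L 0) := by
  simp [orthoPoly, diagCoeff, orthoNorm]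

theorem orthoPoly_add_two (n : ℕ) : orthoPoly L (n + 2) =
    (X - C (diagCoeff L (n + 1))) * orthoPoly L (n + 1)
      - C (offDiagCoeff L (n + 1)) * orthoPoly L n := by
  rw [orthoPoly, diagCoeff, offDiagCoeff, orthoNorm, orthoNorm]

theorem orthoRem_zero : orthoRem L 0 = 0 := by
  rw [orthoRem, zero_add, orthoPoly_one, orthoPoly_zero]; ring

theorem orthoRem_succ (n : ℕ) :
    orthoRem L (n + 1) = C (offDiagCoeff L (n + 1)) * orthoPoly L n := by
  rw [orthoRem, orthoPoly_add_two]; ring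

theorem X_mul_orthoPoly (n : ℕ) : X * orthoPoly L n =
    orthoPoly L (n + 1) + C (diagCoeff L n) * orthoPoly L n + orthoRem L n := by
  rw [orthoRem]; ring

theorem orthoPoly_monic_natDegree (n : ℕ) :
    ((orthoPoly L n).Monic ∧ (orthoPoly L n).natDegree = n) ∧
      ((orthoPoly L (n + 1)).Monic ∧ (orthoPoly L (n + 1)).natDegree = n + 1) := by
  induction n with
  | zero =>
    refine ⟨⟨by simp, by simp⟩, ?_⟩
    rw [orthoPoly_one]
    exact ⟨monic_X_sub_C _, natDegree_X_sub_C _⟩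
  | succ n ih =>
    refine ⟨ih.2, ?_⟩
    obtain ⟨⟨h0, d0⟩, h1, d1⟩ := ih
    set q := (X - C (diagCoeff L (n + 1))) * orthoPoly L (n + 1) with hq
    have hm : q.Monic := (monic_X_sub_C _).mul h1
    have hd : q.natDegree = n + 2 := by
      rw [hq, (monic_X_sub_C _).natDegree_mul h1, natDegree_X_sub_C, d1]; ring
    have hlt : (C (offDiagCoeff L (n + 1)) * orthoPoly L n).degree < q.degree := by
      rw [degree_eq_natDegree hm.ne_zero, hd]
      refine (degree_C_mul_le_degree _ _).trans_lt ?_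
      rw [degree_eq_natDegree h0.ne_zero, d0]
      exact_mod_cast (by omega : n < n + 2)
    rw [show n + 1 + 1 = n + 2 from rfl, orthoPoly_add_two, ← hq]
    refine ⟨hm.sub_of_left hlt, ?_⟩
    rw [natDegree_eq_of_degree_eq (degree_sub_eq_left_of_degree_lt hlt), hd]

theorem orthoPoly_monic (n : ℕ) : (orthoPoly L n).Monic :=
  (orthoPoly_monic_natDegree L n).1.1

theorem natDegree_orthoPoly (n : ℕ) : (orthoPoly L n).natDegree = n :=
  (orthoPoly_monic_natDegree L n).1.2

theorem coeff_orthoPoly_self (n : ℕ) : (orthoPoly L n).coeff n = 1 := by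
  have := orthoPoly_monic L n
  rwa [Monic, leadingCoeff, natDegree_orthoPoly] at this

theorem degree_orthoPoly (n : ℕ) : (orthoPoly L n).degree = n := by
  rw [degree_eq_natDegree (orthoPoly_monic L n).ne_zero, natDegree_orthoPoly]

theorem degree_orthoPoly_lt {n m : ℕ} (h : n < m) : (orthoPoly L n).degree < m := by
  rw [degree_orthoPoly]; exact_mod_cast h

theorem degree_X_mul_lt {q : ℝ[X]} {n : ℕ} (hq : q.degree < n) :
    (X * q : ℝ[X]).degree < (n + 1 : ℕ) := by
  rw [degree_lt_iff_coeff_zero] at hq ⊢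
  intro m hm
  obtain ⟨k, rfl⟩ : ∃ k, m = k + 1 := ⟨m - 1, by omega⟩
  rw [coeff_X_mul]
  exact hq k (by omega)

theorem degree_X_mul_derivative_lt {q : ℝ[X]} {n : ℕ} (hq : q.degree < n) :
    (X * derivative q : ℝ[X]).degree < n := by
  rw [degree_lt_iff_coeff_zero] at hq ⊢
  intro m hm
  rcases m with _ | k
  · simp
  · rw [coeff_X_mul, coeff_derivative, hq _ hm, zero_mul]

variable {L}

theorem orthoNorm_pos (hL : IsPosDefFunctional L) (n : ℕ) : 0 < orthoNorm L n :=
  hL _ (orthoPoly_monic L n).ne_zero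

theorem map_orthoPoly_mul_aux {n : ℕ} (h : ∀ q : ℝ[X], q.degree < n → L (orthoPoly L n * q) = 0)
    {q : ℝ[X]} (hq : q.degree < (n + 1 : ℕ)) :
    L (orthoPoly L n * q) = q.coeff n * orthoNorm L n := by
  have h1 := h _ (degree_sub_C_coeff_mul_lt (orthoPoly_monic L n) (natDegree_orthoPoly L n) hq)
  rw [mul_sub, map_sub, mul_left_comm, map_C_mul] at h1
  rw [orthoNorm]; linarith

/-- Orthogonality for two consecutive indices at once, as the recursion has two steps. -/
theorem map_orthoPoly_mul_eq_zero_aux (hL : IsPosDefFunctional L) (n : ℕ) :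
    (∀ q : ℝ[X], q.degree < n → L (orthoPoly L n * q) = 0) ∧
      (∀ q : ℝ[X], q.degree < (n + 1 : ℕ) → L (orthoPoly L (n + 1) * q) = 0) := by
  induction n with
  | zero =>
    refine ⟨fun q hq => ?_, fun q hq => ?_⟩
    · have : q = 0 := by simpa [Nat.WithBot.lt_zero_iff] using hq
      simp [this]
    · have hq' : q.degree ≤ 0 := Nat.WithBot.lt_one_iff_le_zero.1 (by simpa using hq)
      rw [eq_C_of_degree_le_zero hq', mul_comm, map_C_mul, zero_add, orthoPoly_one]
      have h := (orthoNorm_pos hL 0).ne'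
      have h2 : L (X - C (diagCoeff L 0)) = 0 := by
        have : X - C (diagCoeff L 0) = X - C (diagCoeff L 0) * 1 := by ring
        rw [this, map_sub, map_C_mul, diagCoeff]
        simp only [orthoNorm, orthoPoly_zero, mul_one] at h ⊢
        field_simp
        ring
      rw [h2, mul_zero]
  | succ n ih =>
    refine ⟨ih.2, fun q hq => ?_⟩
    obtain ⟨o0, o1⟩ := ih
    have h0 := (orthoNorm_pos hL n).ne'
    have h1 := (orthoNorm_pos hL (n + 1)).ne'
    have expand : ∀ r : ℝ[X], L (orthoPoly L (n + 2) * r) = L (orthoPoly L (n + 1) * (X * r))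
        - diagCoeff L (n + 1) * L (orthoPoly L (n + 1) * r)
        - offDiagCoeff L (n + 1) * L (orthoPoly L n * r) := by
      intro r
      rw [orthoPoly_add_two, ← map_C_mul, ← map_C_mul, ← map_sub, ← map_sub]
      congr 1; ring
    have e1 : L (orthoPoly L (n + 2) * orthoPoly L (n + 1)) = 0 := by
      have : L (orthoPoly L (n + 1) * (X * orthoPoly L (n + 1))) =
          diagCoeff L (n + 1) * orthoNorm L (n + 1) := by
        rw [diagCoeff, div_mul_cancel₀ _ h1, mul_left_comm]
      rw [expand, this, mul_comm (orthoPoly L n), o1 _ (degree_orthoPoly_lt L n.lt_succ_self),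
        orthoNorm]
      ring
    have e0 : L (orthoPoly L (n + 2) * orthoPoly L n) = 0 := by
      rw [expand, map_orthoPoly_mul_aux o1
        (degree_X_mul_lt (degree_orthoPoly_lt L n.lt_succ_self)), coeff_X_mul,
        coeff_orthoPoly_self, o1 _ (degree_orthoPoly_lt L n.lt_succ_self), offDiagCoeff,
        ← orthoNorm, div_mul_cancel₀ _ h0]
      ring
    -- subtract multiples of `Pₙ₊₁` and `Pₙ` from `q` to bring its degree below `n`
    set r := q - C (q.coeff (n + 1)) * orthoPoly L (n + 1) with hr
    have hr' : r.degree < (n + 1 : ℕ) :=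
      degree_sub_C_coeff_mul_lt (orthoPoly_monic L _) (natDegree_orthoPoly L _) hq
    set s := r - C (r.coeff n) * orthoPoly L n with hs
    have hs' : s.degree < n :=
      degree_sub_C_coeff_mul_lt (orthoPoly_monic L _) (natDegree_orthoPoly L _) hr'
    have es : L (orthoPoly L (n + 2) * s) = 0 := by
      rw [expand, o0 s hs', o1 s (hs'.trans (by exact_mod_cast n.lt_succ_self)),
        o1 _ (degree_X_mul_lt hs')]
      ring
    have hq' : orthoPoly L (n + 2) * q = orthoPoly L (n + 2) * s
        + C (r.coeff n) * (orthoPoly L (n + 2) * orthoPoly L n)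
        + C (q.coeff (n + 1)) * (orthoPoly L (n + 2) * orthoPoly L (n + 1)) := by
      rw [hs]
      nth_rewrite 2 [hr]
      ring
    rw [show n + 1 + 1 = n + 2 from rfl, hq', map_add, map_add, map_C_mul, map_C_mul, es, e0, e1]
    ring

/-- `Pₙ` is orthogonal to all polynomials of smaller degree. -/
theorem map_orthoPoly_mul_eq_zero (hL : IsPosDefFunctional L) {n : ℕ} {q : ℝ[X]}
    (hq : q.degree < n) : L (orthoPoly L n * q) = 0 :=
  (map_orthoPoly_mul_eq_zero_aux hL n).1 q hq

theorem map_orthoPoly_mul (hL : IsPosDefFunctional L) {n : ℕ} {q : ℝ[X]}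
    (hq : q.degree < (n + 1 : ℕ)) : L (orthoPoly L n * q) = q.coeff n * orthoNorm L n :=
  map_orthoPoly_mul_aux (map_orthoPoly_mul_eq_zero_aux hL n).1 hq

theorem map_orthoPoly_mul_orthoPoly (hL : IsPosDefFunctional L) {m n : ℕ} (h : m ≠ n) :
    L (orthoPoly L m * orthoPoly L n) = 0 := by
  rcases h.lt_or_gt with h | h
  · rw [mul_comm]; exact map_orthoPoly_mul_eq_zero hL (degree_orthoPoly_lt L h)
  · exact map_orthoPoly_mul_eq_zero hL (degree_orthoPoly_lt L h)

/-- A polynomial of degree at most `n` which is orthogonal to all polynomials of degree less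
than `n` and to `Pₙ` vanishes. -/
theorem eq_zero_of_map_mul_eq_zero (hL : IsPosDefFunctional L) {n : ℕ} {q : ℝ[X]}
    (hq : q.degree < (n + 1 : ℕ)) (h : ∀ r : ℝ[X], r.degree < n → L (q * r) = 0)
    (hn : L (q * orthoPoly L n) = 0) : q = 0 := by
  by_contra hne
  have h1 := h _ (degree_sub_C_coeff_mul_lt (orthoPoly_monic L n) (natDegree_orthoPoly L n) hq)
  rw [mul_sub, map_sub, mul_left_comm, map_C_mul, hn] at h1
  have := hL q hne
  linarith

/-- Uniqueness of the monic orthogonal polynomials. -/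
theorem eq_orthoPoly (hL : IsPosDefFunctional L) {p : ℕ → ℝ[X]} (hm : ∀ n, (p n).Monic)
    (hd : ∀ n, (p n).natDegree = n) (ho : ∀ m n, m ≠ n → L (p m * p n) = 0) (n : ℕ) :
    p n = orthoPoly L n := by
  induction n using Nat.strong_induction_on with
  | _ n ih =>
  have hsub : (p n - orthoPoly L n).degree < n := by
    have := degree_sub_C_coeff_mul_lt (q := p n) (orthoPoly_monic L n) (natDegree_orthoPoly L n)
      (by rw [degree_eq_natDegree (hm n).ne_zero, hd]; exact_mod_cast n.lt_succ_self)
    have hc : (p n).coeff n = 1 := by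
      have := hm n
      rwa [Monic, leadingCoeff, hd] at this
    simpa [hc] using this
  rw [← sub_eq_zero]
  -- the difference has degree less than `n`, and is orthogonal to `P₀, …, Pₙ₋₁`
  have key : ∀ m ≤ n, (p n - orthoPoly L n).degree < m → p n - orthoPoly L n = 0 := by
    intro m
    induction m with
    | zero => intro _ h; simpa [Nat.WithBot.lt_zero_iff] using h
    | succ m ihm =>
      intro hmn h
      refine ihm (by omega) ?_
      have h1 := map_orthoPoly_mul hL h
      rw [mul_sub, map_sub, map_orthoPoly_mul_orthoPoly hL (by omega), ← ih m (by omega),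
        ho _ _ (by omega), sub_zero, eq_comm, mul_eq_zero,
        or_iff_left (orthoNorm_pos hL m).ne'] at h1
      rw [degree_lt_iff_coeff_zero] at h ⊢
      intro k hk
      rcases hk.eq_or_lt with rfl | hk
      · exact h1
      · exact h k hk
  exact key n le_rfl hsub

theorem diagCoeff_mul_orthoNorm (hL : IsPosDefFunctional L) (n : ℕ) :
    L (X * (orthoPoly L n * orthoPoly L n)) = diagCoeff L n * orthoNorm L n := by
  rw [diagCoeff, div_mul_cancel₀ _ (orthoNorm_pos hL n).ne']

theorem offDiagCoeff_succ_mul_orthoNorm (hL : IsPosDefFunctional L) (n : ℕ) :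
    offDiagCoeff L (n + 1) * orthoNorm L n = orthoNorm L (n + 1) := by
  rw [offDiagCoeff, div_mul_cancel₀ _ (orthoNorm_pos hL n).ne']

theorem offDiagCoeff_succ_ne_zero (hL : IsPosDefFunctional L) (n : ℕ) :
    offDiagCoeff L (n + 1) ≠ 0 :=
  (div_pos (orthoNorm_pos hL _) (orthoNorm_pos hL n)).ne'

theorem map_orthoPoly_mul_orthoRem (hL : IsPosDefFunctional L) (n : ℕ) :
    L (orthoPoly L n * orthoRem L n) = 0 := by
  rcases n with _ | n
  · rw [orthoRem_zero, mul_zero, map_zero]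
  · rw [orthoRem_succ, mul_left_comm, map_C_mul, map_orthoPoly_mul_orthoPoly hL (by omega),
      mul_zero]

theorem map_orthoPoly_mul_X_mul_orthoRem (hL : IsPosDefFunctional L) (n : ℕ) :
    L (orthoPoly L n * (X * orthoRem L n)) = offDiagCoeff L n * orthoNorm L n := by
  rcases n with _ | n
  · rw [orthoRem_zero, mul_zero, mul_zero, map_zero, offDiagCoeff, zero_mul]
  · rw [orthoRem_succ, mul_left_comm X, mul_left_comm, map_C_mul,
      map_orthoPoly_mul hL (degree_X_mul_lt (degree_orthoPoly_lt L n.lt_succ_self)),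
      coeff_X_mul, coeff_orthoPoly_self, one_mul]

theorem degree_orthoRem_lt (n : ℕ) : (orthoRem L n).degree < n := by
  rcases n with _ | n
  · rw [orthoRem_zero, degree_zero]; exact WithBot.bot_lt_coe _
  · rw [orthoRem_succ]
    exact (degree_C_mul_le_degree _ _).trans_lt (degree_orthoPoly_lt L n.lt_succ_self)

theorem map_orthoPoly_succ_mul_X_mul_orthoPoly (hL : IsPosDefFunctional L) (n : ℕ) :
    L (orthoPoly L (n + 1) * (X * orthoPoly L n)) = orthoNorm L (n + 1) := by
  rw [map_orthoPoly_mul hL (degree_X_mul_lt (degree_orthoPoly_lt L n.lt_succ_self)),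
    coeff_X_mul, coeff_orthoPoly_self, one_mul]

/-- Two consecutive orthogonal polynomials have no common zero. -/
theorem orthoPoly_eval_ne_zero (hL : IsPosDefFunctional L) (x : ℝ) (n : ℕ) :
    ¬ ((orthoPoly L n).eval x = 0 ∧ (orthoPoly L (n + 1)).eval x = 0) := by
  induction n with
  | zero => simp
  | succ n ih =>
    rintro ⟨h1, h2⟩
    rw [orthoPoly_add_two, eval_sub, eval_mul, h1, mul_zero, zero_sub, neg_eq_zero, eval_mul,
      eval_C, mul_eq_zero, or_iff_right (offDiagCoeff_succ_ne_zero hL n)] at h2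
    exact ih ⟨h2, h1⟩

/-! ### String equations for a functional satisfying a Pearson relation -/

/-- The relation satisfied by `L p = ∫ p(u) |u|^γ exp(-u² - 2tu) du`, which expresses that the
integral of the derivative of `u p(u) |u|^γ exp(-u² - 2tu)` vanishes. -/
def IsPearsonFunctional (γ t : ℝ) (L : ℝ[X] →ₗ[ℝ] ℝ) : Prop :=
  ∀ p : ℝ[X], L (X * derivative p) + (1 + γ) * L p - 2 * L (X * (X * p)) - 2 * t * L (X * p) = 0

theorem map_X_mul_orthoPoly_mul_X_mul_orthoPoly (hL : IsPosDefFunctional L) (n : ℕ) :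
    L (X * (X * (orthoPoly L n * orthoPoly L n))) =
      (offDiagCoeff L (n + 1) + diagCoeff L n ^ 2 + offDiagCoeff L n) * orthoNorm L n := by
  have : X * (X * (orthoPoly L n * orthoPoly L n)) =
      orthoPoly L (n + 1) * (X * orthoPoly L n)
        + C (diagCoeff L n) * (X * (orthoPoly L n * orthoPoly L n))
        + orthoPoly L n * (X * orthoRem L n) := by rw [orthoRem]; ring
  rw [this, map_add, map_add, map_C_mul, map_orthoPoly_succ_mul_X_mul_orthoPoly hL,
    diagCoeff_mul_orthoNorm hL, map_orthoPoly_mul_X_mul_orthoRem hL,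
    ← offDiagCoeff_succ_mul_orthoNorm hL]
  ring

theorem map_orthoPoly_mul_X_mul_derivative (hL : IsPosDefFunctional L) (n : ℕ) :
    L (orthoPoly L n * (X * derivative (orthoPoly L n))) = n * orthoNorm L n := by
  rw [map_orthoPoly_mul hL (degree_X_mul_derivative_lt (degree_orthoPoly_lt L n.lt_succ_self))]
  congr 1
  rcases n with _ | n
  · simp
  · rw [coeff_X_mul, coeff_derivative, coeff_orthoPoly_self]; push_cast; ring

/-- The first string equation, obtained from the Pearson relation for `Pₙ²`. -/
theorem string_equation_add (hL : IsPosDefFunctional L) {γ t : ℝ} (hP : IsPearsonFunctional γ t L)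
    (n : ℕ) : 2 * (offDiagCoeff L (n + 1) + offDiagCoeff L n
      + diagCoeff L n * (diagCoeff L n + t)) = 2 * n + 1 + γ := by
  have h := hP (orthoPoly L n * orthoPoly L n)
  have hd : X * derivative (orthoPoly L n * orthoPoly L n) =
      C 2 * (orthoPoly L n * (X * derivative (orthoPoly L n))) := by
    rw [derivative_mul, C_ofNat]; ring
  rw [hd, map_C_mul, map_orthoPoly_mul_X_mul_derivative hL,
    map_X_mul_orthoPoly_mul_X_mul_orthoPoly hL, diagCoeff_mul_orthoNorm hL, ← orthoNorm] at h
  refine mul_right_cancel₀ (orthoNorm_pos hL n).ne' ?_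
  linear_combination -h

/-- The lowering relation `X Pₙ' = (n - 2bₙ) Pₙ + 2 (X + aₙ + t) bₙ Pₙ₋₁`. The difference of the
two sides has degree at most `n`, and by the Pearson relation and the recurrence it is orthogonal
to all polynomials of degree at most `n`. -/
theorem X_mul_derivative_orthoPoly (hL : IsPosDefFunctional L) {γ t : ℝ}
    (hP : IsPearsonFunctional γ t L) (n : ℕ) :
    X * derivative (orthoPoly L n) = C (n - 2 * offDiagCoeff L n) * orthoPoly L n
      + C 2 * (X * orthoRem L n) + C (2 * (diagCoeff L n + t)) * orthoRem L n := by
  have hlt : (n : WithBot ℕ) < (n + 1 : ℕ) := by exact_mod_cast n.lt_succ_self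
  have hR := degree_orthoRem_lt (L := L) n
  rw [← sub_eq_zero]
  refine eq_zero_of_map_mul_eq_zero hL (n := n) ?_ (fun q hq => ?_) ?_
  · refine (degree_sub_le _ _).trans_lt (max_lt (degree_X_mul_derivative_lt
      (degree_orthoPoly_lt L n.lt_succ_self)) ?_)
    refine (degree_add_le _ _).trans_lt (max_lt ((degree_add_le _ _).trans_lt (max_lt ?_ ?_)) ?_)
    · exact (degree_C_mul_le_degree _ _).trans_lt (degree_orthoPoly_lt L n.lt_succ_self)
    · exact (degree_C_mul_le_degree _ _).trans_lt (degree_X_mul_lt hR)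
    · exact ((degree_C_mul_le_degree _ _).trans_lt hR).trans hlt
  · have h := hP (orthoPoly L n * q)
    have e1 : X * derivative (orthoPoly L n * q) = X * derivative (orthoPoly L n) * q
        + orthoPoly L n * (X * derivative q) := by rw [derivative_mul]; ring
    have e2 : X * (X * (orthoPoly L n * q)) = orthoPoly L (n + 1) * (X * q)
        + C (diagCoeff L n) * (orthoPoly L n * (X * q)) + X * orthoRem L n * q := by
      rw [orthoRem]; ring
    have e3 : X * (orthoPoly L n * q) = orthoPoly L n * (X * q) := by ring
    have e4 : orthoRem L n * q = orthoPoly L n * (X * q)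
        - C (diagCoeff L n) * (orthoPoly L n * q) - orthoPoly L (n + 1) * q := by
      rw [orthoRem]; ring
    have z1 := map_orthoPoly_mul_eq_zero hL hq
    have z2 := map_orthoPoly_mul_eq_zero hL (degree_X_mul_derivative_lt hq)
    have z3 := map_orthoPoly_mul_eq_zero hL (n := n + 1) (hq.trans hlt)
    have z4 := map_orthoPoly_mul_eq_zero hL (degree_X_mul_lt hq)
    have e5 := congrArg L e4
    rw [map_sub, map_sub, map_C_mul, z1, z3] at e5
    rw [e1, e2, e3, map_add, map_add, map_add, map_C_mul, z1, z2, z4] at h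
    simp only [sub_mul, add_mul, mul_assoc, map_sub, map_add, map_C_mul] at h ⊢
    rw [z1]
    linear_combination h - 2 * (diagCoeff L n + t) * e5
  · simp only [sub_mul, add_mul, mul_assoc, map_sub, map_add, map_C_mul]
    have e1 := map_orthoPoly_mul_X_mul_derivative hL n
    have e2 := map_orthoPoly_mul_X_mul_orthoRem hL n
    have e3 := map_orthoPoly_mul_orthoRem hL n
    rw [mul_comm, mul_assoc] at e1 e2
    rw [mul_comm] at e3
    rw [e1, e2, e3, ← orthoNorm]
    ring

/-- The second string equation: the lowering relations for `Pₙ` and `Pₙ₊₁`, evaluated at the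
zero `0` of `X`, are a homogeneous linear system for `(Pₙ(0), Pₙ₊₁(0)) ≠ 0`, so its determinant
vanishes. -/
theorem string_equation_mul (hL : IsPosDefFunctional L) {γ t : ℝ}
    (hP : IsPearsonFunctional γ t L) (n : ℕ) :
    4 * offDiagCoeff L (n + 1) * (diagCoeff L (n + 1) + t) * (diagCoeff L n + t) =
      (2 * offDiagCoeff L (n + 1) - (n + 1)) * (2 * offDiagCoeff L (n + 1) - (n + 1) - γ) := by
  have h0 := congrArg (eval 0) (X_mul_derivative_orthoPoly hL hP n)
  have h1 := congrArg (eval 0) (X_mul_derivative_orthoPoly hL hP (n + 1))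
  have hs := string_equation_add hL hP n
  rw [orthoRem_succ] at h1
  simp only [eval_mul, eval_X, eval_add, eval_C, zero_mul, mul_zero, add_zero, Nat.cast_add,
    Nat.cast_one, orthoRem, eval_sub, zero_sub] at h0 h1
  have hne := orthoPoly_eval_ne_zero hL 0 n
  set y := (orthoPoly L n).eval 0
  set x := (orthoPoly L (n + 1)).eval 0
  set b := offDiagCoeff L (n + 1)
  set α := diagCoeff L n + t
  have h0' : (2 * b - (n + 1) - γ) * y = 2 * α * x := by linear_combination -h0 + y * hs
  by_cases hy : y = 0
  · have hx : x ≠ 0 := fun hx => hne ⟨hy, hx⟩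
    refine mul_right_cancel₀ hx ?_
    linear_combination (-2 * b * (diagCoeff L (n + 1) + t)) * h0' - (2 * b - (n + 1) - γ) * h1
  · refine mul_right_cancel₀ hy ?_
    linear_combination (-(2 * b - (n + 1))) * h0' - 2 * α * h1

end Functional

/-! ### Deformation of the functional: Toda equations -/

/-- `F'` is the derivative at `t` of the family `F` of polynomials of bounded degree, coefficient
by coefficient. -/
structure HasPolyDerivAt (F : ℝ → ℝ[X]) (F' : ℝ[X]) (t : ℝ) : Prop where
  exists_bound : ∃ N, ∀ s, (F s).natDegree < N
  coeff : ∀ k, HasDerivAt (fun s => (F s).coeff k) (F'.coeff k) t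

namespace HasPolyDerivAt

variable {F G : ℝ → ℝ[X]} {F' G' : ℝ[X]} {t : ℝ}

theorem const (p : ℝ[X]) : HasPolyDerivAt (fun _ => p) 0 t :=
  ⟨⟨p.natDegree + 1, fun _ => Nat.lt_succ_self _⟩, fun k => by
    simpa using hasDerivAt_const t (p.coeff k)⟩

theorem C_comp {c : ℝ → ℝ} {c' : ℝ} (hc : HasDerivAt c c' t) :
    HasPolyDerivAt (fun s => C (c s)) (C c') t := by
  refine ⟨⟨1, fun s => by simp⟩, fun k => ?_⟩
  rcases k with _ | k
  · simpa using hc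
  · simpa [coeff_C] using hasDerivAt_const t (0 : ℝ)

theorem sub (hF : HasPolyDerivAt F F' t) (hG : HasPolyDerivAt G G' t) :
    HasPolyDerivAt (fun s => F s - G s) (F' - G') t := by
  obtain ⟨⟨N, hN⟩, hF⟩ := hF
  obtain ⟨⟨M, hM⟩, hG⟩ := hG
  refine ⟨⟨max N M, fun s => (natDegree_sub_le _ _).trans_lt (max_lt_max (hN s) (hM s))⟩,
    fun k => ?_⟩
  simpa only [coeff_sub] using (hF k).fun_sub (hG k)

theorem mul (hF : HasPolyDerivAt F F' t) (hG : HasPolyDerivAt G G' t) :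
    HasPolyDerivAt (fun s => F s * G s) (F' * G t + F t * G') t := by
  obtain ⟨⟨N, hN⟩, hF⟩ := hF
  obtain ⟨⟨M, hM⟩, hG⟩ := hG
  refine ⟨⟨N + M, fun s => natDegree_mul_le.trans_lt (add_lt_add (hN s) (hM s))⟩, fun k => ?_⟩
  simp only [coeff_add, coeff_mul, ← Finset.sum_add_distrib]
  exact HasDerivAt.fun_sum fun i _ => (hF i.1).fun_mul (hG i.2)

theorem degree_lt {n : ℕ} (hF : HasPolyDerivAt F F' t) (hm : ∀ s, (F s).Monic)
    (hn : ∀ s, (F s).natDegree = n) : F'.degree < n := by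
  rw [degree_lt_iff_coeff_zero]
  intro k hk
  have hc : (fun s => (F s).coeff k) = fun _ => if k = n then 1 else 0 := by
    funext s
    split_ifs with h
    · rw [h, ← hn s]; exact hm s
    · exact coeff_eq_zero_of_natDegree_lt (by rw [hn]; omega)
  have h := hF.coeff k
  rw [hc] at h
  exact h.unique (hasDerivAt_const t _)

end HasPolyDerivAt

theorem map_eq_sum_range (L : ℝ[X] →ₗ[ℝ] ℝ) {p : ℝ[X]} {N : ℕ} (hp : p.natDegree < N) :
    L p = ∑ k ∈ Finset.range N, p.coeff k * L (X ^ k) := by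
  conv_lhs => rw [as_sum_range_C_mul_X_pow' p hp, map_sum]
  exact Finset.sum_congr rfl fun k _ => map_C_mul L _ _

/-- The relations `d/dt L_t (Xᵏ) = -2 L_t (Xᵏ⁺¹)`, satisfied by
`L_t p = ∫ p(u) exp(-2tu) dμ(u)`. -/
def IsTodaFlow (L : ℝ → ℝ[X] →ₗ[ℝ] ℝ) : Prop :=
  ∀ (k : ℕ) (t : ℝ), HasDerivAt (fun s => L s (X ^ k)) (-2 * L t (X ^ (k + 1))) t

section Toda

variable {L : ℝ → ℝ[X] →ₗ[ℝ] ℝ} {t : ℝ}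

theorem IsTodaFlow.hasDerivAt (hD : IsTodaFlow L) {F : ℝ → ℝ[X]} {F' : ℝ[X]}
    (hF : HasPolyDerivAt F F' t) :
    HasDerivAt (fun s => L s (F s)) (L t F' - 2 * L t (X * F t)) t := by
  obtain ⟨⟨N, hN⟩, hF⟩ := hF
  have hF' : F'.natDegree < N + 1 := by
    rw [Nat.lt_succ_iff, natDegree_le_iff_coeff_eq_zero]
    intro k hk
    have h := hF k
    simp only [fun s => coeff_eq_zero_of_natDegree_lt ((hN s).trans hk)] at h
    exact h.unique (hasDerivAt_const t _)
  have e1 : (fun s => L s (F s)) =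
      fun s => ∑ k ∈ Finset.range (N + 1), (F s).coeff k * L s (X ^ k) := by
    funext s; exact map_eq_sum_range _ ((hN s).trans N.lt_succ_self)
  have e2 : L t (X * F t) = ∑ k ∈ Finset.range (N + 1), (F t).coeff k * L t (X ^ (k + 1)) := by
    conv_lhs => rw [as_sum_range_C_mul_X_pow' (F t) ((hN t).trans N.lt_succ_self),
      Finset.mul_sum, map_sum]
    refine Finset.sum_congr rfl fun k _ => ?_
    rw [mul_left_comm, map_C_mul, pow_succ']
  rw [e1, e2, map_eq_sum_range _ hF', Finset.mul_sum, ← Finset.sum_sub_distrib]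
  convert! HasDerivAt.fun_sum fun k _ => (hF k).fun_mul (hD k t) using 2 with k
  ring

theorem hasDerivAt_orthoNorm (hL : ∀ s, IsPosDefFunctional (L s)) (hD : IsTodaFlow L) {n : ℕ}
    {F' : ℝ[X]} (hF : HasPolyDerivAt (fun s => orthoPoly (L s) n) F' t) :
    HasDerivAt (fun s => orthoNorm (L s) n) (-2 * diagCoeff (L t) n * orthoNorm (L t) n) t := by
  have hlt := hF.degree_lt (fun s => orthoPoly_monic (L s) n) (fun s => natDegree_orthoPoly (L s) n)
  convert! hD.hasDerivAt (hF.mul hF) using 1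
  rw [map_add, mul_comm F', map_orthoPoly_mul_eq_zero (hL t) hlt, diagCoeff_mul_orthoNorm (hL t)]
  ring

theorem exists_hasPolyDerivAt_orthoPoly (hL : ∀ s, IsPosDefFunctional (L s)) (hD : IsTodaFlow L)
    (t : ℝ) (n : ℕ) : (∃ F', HasPolyDerivAt (fun s => orthoPoly (L s) n) F' t) ∧
      ∃ F', HasPolyDerivAt (fun s => orthoPoly (L s) (n + 1)) F' t := by
  have hdiag : ∀ n F', HasPolyDerivAt (fun s => orthoPoly (L s) n) F' t →
      ∃ a', HasDerivAt (fun s => diagCoeff (L s) n) a' t := fun n F' hF =>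
    ⟨_, (hD.hasDerivAt ((HasPolyDerivAt.const X).mul (hF.mul hF))).fun_div
      (hasDerivAt_orthoNorm hL hD hF) (orthoNorm_pos (hL t) n).ne'⟩
  induction n with
  | zero =>
    have h0 : HasPolyDerivAt (fun s => orthoPoly (L s) 0) 0 t := by
      simp only [orthoPoly_zero]; exact HasPolyDerivAt.const 1
    obtain ⟨a', ha⟩ := hdiag 0 0 h0
    refine ⟨⟨0, h0⟩, ?_⟩
    simp only [zero_add, orthoPoly_one]
    exact ⟨_, (HasPolyDerivAt.const X).sub (HasPolyDerivAt.C_comp ha)⟩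
  | succ n ih =>
    obtain ⟨⟨F', hF⟩, G', hG⟩ := ih
    obtain ⟨a', ha⟩ := hdiag (n + 1) G' hG
    have hb := (hasDerivAt_orthoNorm hL hD hG).fun_div (hasDerivAt_orthoNorm hL hD hF)
      (orthoNorm_pos (hL t) n).ne'
    refine ⟨⟨G', hG⟩, ?_⟩
    simp only [add_assoc, Nat.reduceAdd, orthoPoly_add_two]
    exact ⟨_, (((HasPolyDerivAt.const X).sub (HasPolyDerivAt.C_comp ha)).mul hG).sub
      ((HasPolyDerivAt.C_comp hb).mul hF)⟩

/-- The derivative of the subleading coefficient of `Pₙ`, found by differentiating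
`L (Pₙ Pₙ₋₁) = 0`. -/
theorem coeff_X_mul_deriv_orthoPoly (hL : ∀ s, IsPosDefFunctional (L s)) (hD : IsTodaFlow L)
    {n : ℕ} {F' : ℝ[X]} (hF : HasPolyDerivAt (fun s => orthoPoly (L s) n) F' t) :
    (X * F').coeff n = 2 * offDiagCoeff (L t) n := by
  rcases n with _ | n
  · rw [offDiagCoeff]; simp
  · obtain ⟨G', hG⟩ := (exists_hasPolyDerivAt_orthoPoly hL hD t n).1
    have hF1 := hF.degree_lt (fun s => orthoPoly_monic (L s) _)
      (fun s => natDegree_orthoPoly (L s) _)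
    have hG1 := hG.degree_lt (fun s => orthoPoly_monic (L s) n)
      (fun s => natDegree_orthoPoly (L s) n)
    have h := hD.hasDerivAt (hF.mul hG)
    simp only [fun s => map_orthoPoly_mul_orthoPoly (hL s) n.succ_ne_self] at h
    have h := h.unique (hasDerivAt_const t _)
    rw [map_add, mul_comm F', map_orthoPoly_mul (hL t) hF1, mul_left_comm X,
      map_orthoPoly_succ_mul_X_mul_orthoPoly (hL t),
      map_orthoPoly_mul_eq_zero (hL t) (hG1.trans (by exact_mod_cast n.lt_succ_self)),
      ← offDiagCoeff_succ_mul_orthoNorm (hL t)] at h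
    rw [coeff_X_mul]
    refine mul_right_cancel₀ (orthoNorm_pos (hL t) n).ne' ?_
    linear_combination h

/-- The Toda equation for the diagonal coefficients. -/
theorem hasDerivAt_diagCoeff (hL : ∀ s, IsPosDefFunctional (L s)) (hD : IsTodaFlow L)
    (t : ℝ) (n : ℕ) : HasDerivAt (fun s => diagCoeff (L s) n)
      (2 * (offDiagCoeff (L t) n - offDiagCoeff (L t) (n + 1))) t := by
  obtain ⟨⟨F', hF⟩, G', hG⟩ := exists_hasPolyDerivAt_orthoPoly hL hD t n
  -- `aₙ` is the difference of the subleading coefficients of `Pₙ` and `Pₙ₊₁`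
  have e : ∀ s, diagCoeff (L s) n =
      (X * orthoPoly (L s) n).coeff n - (X * orthoPoly (L s) (n + 1)).coeff (n + 1) := by
    intro s
    have := degree_orthoRem_lt (L := L s) n
    rw [degree_lt_iff_coeff_zero] at this
    rw [X_mul_orthoPoly, coeff_add, coeff_add, coeff_C_mul, coeff_orthoPoly_self, this n le_rfl,
      coeff_X_mul]
    ring
  simp only [e]
  convert! (((HasPolyDerivAt.const X).mul hF).coeff n).fun_sub
    (((HasPolyDerivAt.const X).mul hG).coeff (n + 1)) using 1
  rw [zero_mul, zero_add, zero_mul, zero_add, coeff_X_mul_deriv_orthoPoly hL hD hF,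
    coeff_X_mul_deriv_orthoPoly hL hD hG]
  ring

/-- The Toda equation for the off-diagonal coefficients. -/
theorem hasDerivAt_offDiagCoeff_succ (hL : ∀ s, IsPosDefFunctional (L s)) (hD : IsTodaFlow L)
    (t : ℝ) (n : ℕ) : HasDerivAt (fun s => offDiagCoeff (L s) (n + 1))
      (-2 * offDiagCoeff (L t) (n + 1) * (diagCoeff (L t) (n + 1) - diagCoeff (L t) n)) t := by
  obtain ⟨⟨F', hF⟩, G', hG⟩ := exists_hasPolyDerivAt_orthoPoly hL hD t n
  have h0 := (orthoNorm_pos (hL t) n).ne'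
  convert! (hasDerivAt_orthoNorm hL hD hG).fun_div (hasDerivAt_orthoNorm hL hD hF) h0 using 1
  rw [offDiagCoeff]
  field_simp
  ring

end Toda

/-! ### The functional of the perturbed Hermite weight -/

open ProbabilityTheory in
/-- The Gaussian measure of variance `1/2` has density proportional to `exp(-u²)` and finite
exponential moments. -/
theorem integrable_abs_rpow_mul_exp {γ : ℝ} (hγ : 0 ≤ γ) (s : ℝ) :
    Integrable (fun u : ℝ => |u| ^ γ * Real.exp (-u ^ 2) * Real.exp (s * u)) := by
  have h : Integrable (fun u : ℝ => |u| ^ γ * Real.exp (s * u)) (gaussianReal 0 (1 / 2)) :=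
    integrable_rpow_abs_mul_exp_of_mem_interior_integrableExpSet (X := id)
      (by simp) hγ
  rw [gaussianReal_of_var_ne_zero _ (by norm_num), integrable_withDensity_iff_integrable_smul'
    (measurable_gaussianPDF _ _) (ae_of_all _ fun _ => gaussianPDF_lt_top)] at h
  convert! h.const_mul √(2 * Real.pi * ((1 / 2 : NNReal) : ℝ)) using 2 with u
  have hπ : √(2 * Real.pi * ((1 / 2 : NNReal) : ℝ)) ≠ 0 := by
    have := Real.pi_pos
    rw [Real.sqrt_ne_zero (by positivity)]
    push_cast; positivity
  rw [toReal_gaussianPDF, gaussianPDFReal, smul_eq_mul]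
  have : -(u - 0) ^ 2 / (2 * ((1 / 2 : NNReal) : ℝ)) = - u ^ 2 := by push_cast; ring
  rw [this]
  field_simp

/-- The measure `|u|^γ exp(-u²) du`. -/
noncomputable def genHermiteMeasure (γ : ℝ) : Measure ℝ :=
  volume.withDensity fun u => ENNReal.ofReal (|u| ^ γ * Real.exp (-u ^ 2))

theorem genHermite_nonneg (γ u : ℝ) : 0 ≤ |u| ^ γ * Real.exp (-u ^ 2) := by positivity

theorem integrable_genHermiteMeasure {γ : ℝ} {g : ℝ → ℝ} : Integrable g (genHermiteMeasure γ) ↔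
    Integrable (fun u => |u| ^ γ * Real.exp (-u ^ 2) * g u) := by
  rw [genHermiteMeasure, integrable_withDensity_iff_integrable_smul' (by fun_prop)
    (ae_of_all _ fun _ => ENNReal.ofReal_lt_top)]
  simp only [ENNReal.toReal_ofReal (genHermite_nonneg γ _), smul_eq_mul]

theorem integral_genHermiteMeasure (γ : ℝ) (g : ℝ → ℝ) : ∫ u, g u ∂(genHermiteMeasure γ) =
    ∫ u, |u| ^ γ * Real.exp (-u ^ 2) * g u := by
  rw [genHermiteMeasure, integral_withDensity_eq_integral_toReal_smul (by fun_prop)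
    (ae_of_all _ fun _ => ENNReal.ofReal_lt_top)]
  simp only [ENNReal.toReal_ofReal (genHermite_nonneg γ _), smul_eq_mul]

open ProbabilityTheory in
theorem integrableExpSet_genHermiteMeasure {γ : ℝ} (hγ : 0 ≤ γ) :
    integrableExpSet id (genHermiteMeasure γ) = Set.univ :=
  Set.eq_univ_of_forall fun s =>
    integrable_genHermiteMeasure.2 (integrable_abs_rpow_mul_exp hγ s)

theorem integrable_eval_mul_exp {γ : ℝ} (hγ : 0 ≤ γ) (p : ℝ[X]) (s : ℝ) :
    Integrable (fun u => p.eval u * Real.exp (s * u)) (genHermiteMeasure γ) := by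
  simp only [eval_eq_sum_range, Finset.sum_mul, mul_assoc]
  refine integrable_finsetSum _ fun k _ => Integrable.const_mul ?_ _
  exact ProbabilityTheory.integrable_pow_mul_exp_of_mem_interior_integrableExpSet (X := id)
    (by simp [integrableExpSet_genHermiteMeasure hγ]) k

/-- The functional `L_t p = ∫ p(u) |u|^γ exp(-u² - 2tu) du`. Up to the factor `exp(-t²)` and the
translation `x = u + t`, it is integration against the perturbed Hermite weight. -/
noncomputable def perturbedFunctional {γ : ℝ} (hγ : 0 ≤ γ) (t : ℝ) : ℝ[X] →ₗ[ℝ] ℝ where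
  toFun p := ∫ u, p.eval u * Real.exp (-2 * t * u) ∂(genHermiteMeasure γ)
  map_add' p q := by
    simp only [eval_add, add_mul]
    exact integral_add (integrable_eval_mul_exp hγ p _) (integrable_eval_mul_exp hγ q _)
  map_smul' c p := by
    simp only [eval_smul, smul_eq_mul, mul_assoc, integral_const_mul, RingHom.id_apply]

theorem perturbedFunctional_apply {γ : ℝ} (hγ : 0 ≤ γ) (t : ℝ) (p : ℝ[X]) :
    perturbedFunctional hγ t p =
    ∫ u, |u| ^ γ * Real.exp (-u ^ 2) * (p.eval u * Real.exp (-2 * t * u)) :=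
  integral_genHermiteMeasure γ _

theorem integrable_perturbed {γ : ℝ} (hγ : 0 ≤ γ) (t : ℝ) (p : ℝ[X]) : Integrable
    (fun u => |u| ^ γ * Real.exp (-u ^ 2) * (p.eval u * Real.exp (-2 * t * u))) :=
  integrable_genHermiteMeasure.1 (integrable_eval_mul_exp hγ p _)

theorem isPosDefFunctional_perturbed {γ : ℝ} (hγ : 0 ≤ γ) (t : ℝ) :
    IsPosDefFunctional (perturbedFunctional hγ t) := by
  intro p hp
  rw [perturbedFunctional_apply, integral_pos_iff_support_of_nonneg _
    (integrable_perturbed hγ t _)]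
  · have hfin : (insert 0 (p.rootSet ℝ)).Finite := (p.rootSet_finite ℝ).insert 0
    have hsub : (insert 0 (p.rootSet ℝ))ᶜ ⊆ Function.support fun u : ℝ =>
        |u| ^ γ * Real.exp (-u ^ 2) * ((p * p).eval u * Real.exp (-2 * t * u)) := by
      intro u hu
      simp only [Set.mem_compl_iff, Set.mem_insert_iff, mem_rootSet, not_or, not_and] at hu
      have h1 : eval u p ≠ 0 := by simpa using hu.2 hp
      have h2 : |u| ^ γ ≠ 0 := (Real.rpow_pos_of_pos (abs_pos.2 hu.1) γ).ne'
      rw [Function.mem_support, eval_mul]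
      have := Real.exp_ne_zero
      exact mul_ne_zero (mul_ne_zero h2 (this _)) (mul_ne_zero (mul_ne_zero h1 h1) (this _))
    refine lt_of_lt_of_le ?_ (measure_mono hsub)
    rw [measure_compl hfin.measurableSet (by simp [hfin.measure_zero]), hfin.measure_zero]
    simp
  · intro u
    have := mul_self_nonneg (eval u p)
    simp only [Pi.zero_apply, eval_mul]
    positivity

theorem isTodaFlow_perturbed {γ : ℝ} (hγ : 0 ≤ γ) : IsTodaFlow (perturbedFunctional hγ) := by
  intro k t
  have h := ProbabilityTheory.hasDerivAt_integral_pow_mul_exp_real (X := id)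
    (μ := genHermiteMeasure γ) (t := -2 * t)
    (by simp [integrableExpSet_genHermiteMeasure hγ]) k
  have h2 : HasDerivAt (fun s : ℝ => -2 * s) (-2) t := by
    simpa using (hasDerivAt_id t).const_mul (-2)
  convert! h.comp t h2 using 1
  · funext s
    simp [perturbedFunctional]
  · simp [perturbedFunctional]
    ring

theorem hasDerivAt_mul_abs_rpow {γ : ℝ} (hγ : 0 ≤ γ) (u : ℝ) :
    HasDerivAt (fun u : ℝ => u * |u| ^ γ) ((1 + γ) * |u| ^ γ) u := by
  rcases eq_or_ne u 0 with rfl | hu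
  · -- the difference quotient at `0` is `|u|^γ`, which is continuous at `0` also if `γ = 0`
    have hc : ContinuousAt (fun u : ℝ => |u| ^ γ) 0 :=
      continuous_abs.continuousAt.rpow_const (Or.inr hγ)
    have hz : (1 + γ) * |(0 : ℝ)| ^ γ = |(0 : ℝ)| ^ γ := by
      rcases hγ.eq_or_lt with rfl | h
      · simp
      · simp [Real.zero_rpow h.ne']
    rw [hz, hasDerivAt_iff_tendsto_slope]
    refine (hc.tendsto.mono_left nhdsWithin_le_nhds).congr' ?_
    filter_upwards [self_mem_nhdsWithin] with v hv
    have hv : v ≠ 0 := hv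
    simp [slope, hv]
  · have h := (hasDerivAt_id' u).fun_mul ((hasDerivAt_abs hu).rpow_const (p := γ)
      (Or.inl (abs_ne_zero.2 hu)))
    convert! h using 1
    have e : |u| ^ γ = |u| ^ (γ - 1) * |u| := by
      rw [← Real.rpow_add_one (abs_ne_zero.2 hu)]; ring_nf
    have e2 : u * (SignType.sign u : ℝ) = |u| := self_mul_sign u
    rw [e]
    linear_combination (-γ * |u| ^ (γ - 1)) * e2

theorem isPearsonFunctional_perturbed {γ : ℝ} (hγ : 0 ≤ γ) (t : ℝ) :
    IsPearsonFunctional γ t (perturbedFunctional hγ t) := by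
  intro p
  have hd : ∀ u : ℝ, HasDerivAt
      (fun u => |u| ^ γ * Real.exp (-u ^ 2) * ((X * p).eval u * Real.exp (-2 * t * u)))
      (|u| ^ γ * Real.exp (-u ^ 2) * ((X * derivative p + C (1 + γ) * p - C 2 * (X * (X * p))
        - C (2 * t) * (X * p)).eval u * Real.exp (-2 * t * u))) u := by
    intro u
    have h1 := hasDerivAt_mul_abs_rpow hγ u
    have h2 : HasDerivAt (fun u : ℝ => Real.exp (-u ^ 2)) _ u := (hasDerivAt_pow 2 u).fun_neg.exp
    have h3 : HasDerivAt (fun u : ℝ => Real.exp (-2 * t * u)) _ u :=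
      ((hasDerivAt_id' u).const_mul (-2 * t)).exp
    convert! ((h1.fun_mul h2).fun_mul ((p.hasDerivAt u).fun_mul h3)) using 1
    · funext v
      simp only [eval_mul, eval_X]; ring
    · simp only [eval_mul, eval_X, eval_add, eval_sub, eval_C]
      push_cast
      ring
  have h := integral_eq_zero_of_hasDerivAt_of_integrable hd (integrable_perturbed hγ t _)
    (integrable_perturbed hγ t _)
  rw [← perturbedFunctional_apply hγ, map_sub, map_sub, map_add, map_C_mul, map_C_mul,
    map_C_mul] at h
  exact h

theorem eval_mul_perturbedHermiteWeight (γ : ℝ) (p : ℝ[X]) (t u : ℝ) :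
    p.eval (u + t) * perturbedHermiteWeight γ t (u + t) = Real.exp (-t ^ 2) *
      (|u| ^ γ * Real.exp (-u ^ 2) * ((taylor t p).eval u * Real.exp (-2 * t * u))) := by
  have : Real.exp (-(u + t) ^ 2) =
      Real.exp (-t ^ 2) * (Real.exp (-u ^ 2) * Real.exp (-2 * t * u)) := by
    rw [← Real.exp_add, ← Real.exp_add]; ring_nf
  rw [perturbedHermiteWeight, this, add_sub_cancel_right, taylor_eval]
  ring

theorem integrable_eval_mul_perturbedHermiteWeight {γ : ℝ} (hγ : 0 ≤ γ) (p : ℝ[X]) (t : ℝ) :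
    Integrable (fun x => p.eval x * perturbedHermiteWeight γ t x) := by
  have h := ((integrable_perturbed hγ t (taylor t p)).const_mul (Real.exp (-t ^ 2)))
  simp only [← eval_mul_perturbedHermiteWeight] at h
  simpa using h.comp_sub_right t

theorem integral_eval_mul_perturbedHermiteWeight {γ : ℝ} (hγ : 0 ≤ γ) (p : ℝ[X]) (t : ℝ) :
    ∫ x, p.eval x * perturbedHermiteWeight γ t x =
      Real.exp (-t ^ 2) * perturbedFunctional hγ t (taylor t p) := by
  rw [← integral_add_right_eq_self _ t]
  simp only [eval_mul_perturbedHermiteWeight]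
  rw [integral_const_mul, ← perturbedFunctional_apply hγ]

/-- The translates of the monic orthogonal polynomials of `L_t` are those of the perturbed Hermite
weight. -/
theorem isMonicOrthogonal_iff {γ : ℝ} (hγ : 0 ≤ γ) (t : ℝ) (p : ℕ → ℝ[X]) :
    IsMonicOrthogonal (perturbedHermiteWeight γ t) p ↔
      ∀ n, taylor t (p n) = orthoPoly (perturbedFunctional hγ t) n := by
  have hL := isPosDefFunctional_perturbed hγ t
  have hI : ∀ m n, ∫ x, (p m).eval x * (p n).eval x * perturbedHermiteWeight γ t x =
      Real.exp (-t ^ 2) * perturbedFunctional hγ t (taylor t (p m) * taylor t (p n)) := by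
    intro m n
    rw [← taylor_mul, ← integral_eval_mul_perturbedHermiteWeight]
    simp only [eval_mul]
  have hM : ∀ n, (taylor t (p n)).Monic ↔ (p n).Monic := fun n => by
    rw [Monic, Monic, leadingCoeff_taylor]
  constructor
  · intro h
    refine eq_orthoPoly hL (fun n => (hM n).2 (h.monic n))
      (fun n => by rw [natDegree_taylor, h.natDegree_eq]) fun m n hmn => ?_
    have := h.orthogonal m n hmn
    rwa [hI, mul_eq_zero, or_iff_right (Real.exp_ne_zero _)] at this
  · intro h
    refine ⟨fun n => (hM n).1 ?_, fun n => ?_, fun m n => ?_, fun m n hmn => ?_, fun n => ?_⟩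
    · rw [h]; exact orthoPoly_monic _ _
    · rw [← natDegree_taylor (p n) t, h, natDegree_orthoPoly]
    · simpa only [eval_mul] using
        integrable_eval_mul_perturbedHermiteWeight hγ (p m * p n) t
    · rw [hI, h, h, map_orthoPoly_mul_orthoPoly hL hmn, mul_zero]
    · rw [hI, h]
      exact mul_pos (Real.exp_pos _) (orthoNorm_pos hL n)

/-- The recurrence coefficients of the translated polynomials: the translation by `t` shifts the
diagonal coefficients by `t`. -/
theorem hasRecurrenceCoeffs_of_taylor_eq {L : ℝ[X] →ₗ[ℝ] ℝ} {t : ℝ} {p : ℕ → ℝ[X]}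
    (h : ∀ n, taylor t (p n) = orthoPoly L n) :
    HasRecurrenceCoeffs p (fun n => diagCoeff L n + t) (offDiagCoeff L) := by
  constructor
  · apply taylor_injective t
    rw [map_add, taylor_mul, taylor_mul, taylor_X, taylor_C, h, h, orthoPoly_one, orthoPoly_zero,
      C_add]
    ring
  · intro n
    apply taylor_injective t
    rw [map_add, map_add, taylor_mul, taylor_mul, taylor_mul, taylor_X, taylor_C, taylor_C, h, h, h,
      orthoPoly_add_two, C_add]
    ring

/-! ### From the string and Toda equations to the Painlevé equation -/

/-- The Toda equation for `bₙ` contains `bₙ αₙ₋₁`, where `αₙ = aₙ + t`; after multiplication by `αₙ`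
the second string equation eliminates it. For `n = 0` both sides vanish, as `b₀ = 0`. -/
theorem exists_deriv_offDiagCoeff {L : ℝ → ℝ[X] →ₗ[ℝ] ℝ} {γ : ℝ}
    (hL : ∀ s, IsPosDefFunctional (L s)) (hD : IsTodaFlow L)
    (hP : ∀ s, IsPearsonFunctional γ s (L s)) (n : ℕ) :
    ∃ b' : ℝ → ℝ, Continuous b' ∧ (∀ t, HasDerivAt (fun s => offDiagCoeff (L s) n) (b' t) t) ∧
      ∀ t, 2 * (diagCoeff (L t) n + t) * b' t =
        -4 * offDiagCoeff (L t) n * (diagCoeff (L t) n + t) ^ 2 +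
          (2 * offDiagCoeff (L t) n - n) * (2 * offDiagCoeff (L t) n - n - γ) := by
  rcases n with _ | n
  · refine ⟨fun _ => 0, continuous_const, fun t => ?_, fun t => ?_⟩
    · simp only [offDiagCoeff]; exact hasDerivAt_const t _
    · simp [offDiagCoeff]
  · refine ⟨_, ?_, fun t => hasDerivAt_offDiagCoeff_succ hL hD t n, fun t => ?_⟩
    · have ca : ∀ m, Continuous fun s => diagCoeff (L s) m := fun m =>
        continuous_iff_continuousAt.2 fun s => (hasDerivAt_diagCoeff hL hD s m).continuousAt
      have cb : Continuous fun s => offDiagCoeff (L s) (n + 1) :=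
        continuous_iff_continuousAt.2 fun s => (hasDerivAt_offDiagCoeff_succ hL hD s n).continuousAt
      exact (continuous_const.mul cb).mul ((ca _).sub (ca _))
    · have h := string_equation_mul (hL t) (hP t) n
      push_cast
      linear_combination h

/-- The Toda equation for `αₙ = aₙ + t`, with `bₙ₊₁` eliminated by the first string equation. -/
theorem hasDerivAt_diagCoeff_add {L : ℝ → ℝ[X] →ₗ[ℝ] ℝ} {γ : ℝ}
    (hL : ∀ s, IsPosDefFunctional (L s)) (hD : IsTodaFlow L)
    (hP : ∀ s, IsPearsonFunctional γ s (L s)) (n : ℕ) (t : ℝ) :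
    HasDerivAt (fun s => diagCoeff (L s) n + s) (2 * (diagCoeff (L t) n + t) *
      (diagCoeff (L t) n + t - t) + 4 * offDiagCoeff (L t) n - 2 * n - γ) t := by
  convert! (hasDerivAt_diagCoeff hL hD t n).fun_add (hasDerivAt_id' t) using 1
  linear_combination string_equation_add (hL t) (hP t) n

/-- Elimination of `b` from a first-order system for `(α, b)`, given the value of `α b'`. -/
theorem contDiff_two_and_equation {α b b' : ℝ → ℝ} {γ n : ℝ} (hb' : Continuous b')
    (hα : ∀ t, HasDerivAt α (2 * α t * (α t - t) + 4 * b t - 2 * n - γ) t)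
    (hb : ∀ t, HasDerivAt b (b' t) t)
    (h : ∀ t, 2 * α t * b' t = -4 * b t * α t ^ 2 + (2 * b t - n) * (2 * b t - n - γ)) :
    ContDiff ℝ 2 α ∧ ∀ t : ℝ, 2 * α t * deriv (deriv α) t =
      (deriv α t) ^ 2 + 12 * (α t) ^ 4 - 16 * t * (α t) ^ 3
        + 4 * (t ^ 2 - γ - 2 * n - 1) * (α t) ^ 2 - γ ^ 2 := by
  have dα : deriv α = fun t => 2 * α t * (α t - t) + 4 * b t - 2 * n - γ :=
    funext fun t => (hα t).deriv
  have db : deriv b = b' := funext fun t => (hb t).deriv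
  have cb : ContDiff ℝ 1 b :=
    contDiff_one_iff_deriv.2 ⟨fun t => (hb t).differentiableAt, db ▸ hb'⟩
  have diffα : Differentiable ℝ α := fun t => (hα t).differentiableAt
  have cα : ContDiff ℝ 1 α := by
    refine contDiff_one_iff_deriv.2 ⟨diffα, ?_⟩
    rw [dα]
    have := diffα.continuous
    have := cb.continuous
    fun_prop
  refine ⟨?_, fun t => ?_⟩
  · rw [show (2 : WithTop ℕ∞) = 1 + 1 by norm_num, contDiff_succ_iff_deriv]
    refine ⟨diffα, by simp, ?_⟩
    rw [dα]
    fun_prop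
  · have d2 := (((((hα t).const_mul 2).fun_mul ((hα t).fun_sub (hasDerivAt_id' t))).fun_add
      ((hb t).const_mul 4)).sub_const (2 * n)).sub_const γ
    rw [← dα] at d2
    rw [d2.deriv, dα]
    linear_combination 4 * h t

theorem isPainleveFourSolutionOn_of_equation {α : ℝ → ℝ} {γ n : ℝ} (hα : ContDiff ℝ 2 α)
    (h : ∀ t : ℝ, α t ≠ 0 → deriv (deriv α) t =
      (deriv α t) ^ 2 / (2 * α t) + 6 * (α t) ^ 3 - 8 * t * (α t) ^ 2
        + 2 * (t ^ 2 - γ - 2 * n - 1) * α t - γ ^ 2 / (2 * α t)) :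
    IsPainleveFourSolutionOn (2 * n + 1 + γ) (-2 * γ ^ 2) (fun s => 2 * α (-s))
      {s : ℝ | α (-s) ≠ 0} := by
  have hcont := hα.continuous
  have d1 : deriv (fun s => 2 * α (-s)) = fun s => -2 * deriv α (-s) := by
    funext s
    rw [deriv_const_mul_field, deriv_comp_neg]
    ring
  refine ⟨isOpen_ne_fun (by fun_prop) continuous_const, ContDiff.contDiffOn (by fun_prop),
    fun s hs => mul_ne_zero two_ne_zero hs, fun s hs => ?_⟩
  have hs' : α (-s) ≠ 0 := hs
  rw [d1, deriv_const_mul_field, deriv_comp_neg, h _ hs']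
  field_simp
  ring

theorem theorem1 (γ : ℝ) (hγ : 0 ≤ γ) :
    -- the monic orthogonal polynomials exist and are unique, for every `t`
    (∀ t : ℝ, ∃! p : ℕ → ℝ[X], IsMonicOrthogonal (perturbedHermiteWeight γ t) p) ∧
    -- their recurrence coefficients exist and satisfy the equation
    ∀ p : ℝ → ℕ → ℝ[X],
      (∀ t, IsMonicOrthogonal (perturbedHermiteWeight γ t) (p t)) →
      ∃ α β : ℕ → ℝ → ℝ,
        (∀ t, HasRecurrenceCoeffs (p t) (fun n => α n t) (fun n => β n t)) ∧
        ∀ n : ℕ,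
          ContDiff ℝ 2 (α n) ∧
          -- the equation multiplied by `2 αₙ`, for every `t`
          (∀ t : ℝ, 2 * α n t * deriv (deriv (α n)) t =
            (deriv (α n) t) ^ 2 + 12 * (α n t) ^ 4 - 16 * t * (α n t) ^ 3
              + 4 * (t ^ 2 - γ - 2 * n - 1) * (α n t) ^ 2 - γ ^ 2) ∧
          -- the equation itself, wherever it makes sense
          (∀ t : ℝ, α n t ≠ 0 → deriv (deriv (α n)) t =
            (deriv (α n) t) ^ 2 / (2 * α n t) + 6 * (α n t) ^ 3 - 8 * t * (α n t) ^ 2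
              + 2 * (t ^ 2 - γ - 2 * n - 1) * α n t - γ ^ 2 / (2 * α n t)) ∧
          -- the equation is a fourth Painlevé equation for `y(s) = 2 αₙ(-s)`
          IsPainleveFourSolutionOn (2 * n + 1 + γ) (-2 * γ ^ 2) (fun s => 2 * α n (-s))
            {s : ℝ | α n (-s) ≠ 0} := by
  have hL := isPosDefFunctional_perturbed hγ
  have hD := isTodaFlow_perturbed hγ
  have hP := isPearsonFunctional_perturbed hγ
  refine ⟨fun t => ⟨fun n => taylor (-t) (orthoPoly (perturbedFunctional hγ t) n), ?_, ?_⟩,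
    fun p hp => ?_⟩
  · refine (isMonicOrthogonal_iff hγ t _).2 fun n => ?_
    rw [taylor_taylor, add_neg_cancel, taylor_zero]
  · intro q hq
    funext n
    rw [← (isMonicOrthogonal_iff hγ t q).1 hq n, taylor_taylor, neg_add_cancel, taylor_zero]
  · refine ⟨fun n t => diagCoeff (perturbedFunctional hγ t) n + t,
      fun n t => offDiagCoeff (perturbedFunctional hγ t) n,
      fun t => hasRecurrenceCoeffs_of_taylor_eq ((isMonicOrthogonal_iff hγ t _).1 (hp t)),
      fun n => ?_⟩
    obtain ⟨b', hc, hb, h⟩ := exists_deriv_offDiagCoeff hL hD hP n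
    obtain ⟨hα, heq⟩ := contDiff_two_and_equation hc
      (hasDerivAt_diagCoeff_add hL hD hP n) hb h
    refine ⟨hα, heq, ?_⟩
    rw [and_iff_left_of_imp (isPainleveFourSolutionOn_of_equation hα)]
    intro t ht
    have := heq t
    field_simp
    linear_combination this
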